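/- Let $n\ge 1$ and let $I_n$ be the path with vertex set $[n+1]=\{1,\dots,n+1\}$ and edges $\{i,i+1\}$, $i\in[n]$. Its cosmological polytope $\mathcal C_{I_n}\subset\mathbb R^{2n+1}$ is the convex hull of the points $x_i+x_{i+1}-x_{e}$, $x_i-x_{i+1}+x_{e}$, $-x_i+x_{i+1}+x_{e}$ for the edges $e=\{i,i+1\}$, where the $x_i$ and $x_e$ are the standard basis vectors indexed by vertices and edges. Let $K$ be a field and let $R_{I_n}$ be the polynomial ring over $K$ in the variables $z_i$ (for the point $x_i$, $i\in[n+1]$) and, for each edge $e=\{i,i+1\}$, $z_{i\,i+1}$ (for $x_e$), $t_{i\,i+1}$ (for $x_i+x_{i+1}-x_e$), $y_{i\,i+1}$ (for $x_i-x_{i+1}+x_e$) and $y_{i+1\,i}$ (for $-x_i+x_{i+1}+x_e$). The toric ideal of $\mathcal C_{I_n}$ is the kernel of the $K$-algebra homomorphism from $R_{I_n}$ to the Laurent polynomial ring that sends each variable to the Laurent monomial whose exponent vector is its point. Use the lexicographic term order with $$y_{12}>y_{23}>\cdots>y_{n\,n+1}>y_{n+1\,n}>\cdots>y_{32}>y_{21}>z_{12}>\cdots>z_{n\,n+1}>t_{12}>\cdots>t_{n\,n+1}>z_1>\cdots>z_{n+1}.$$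 The corresponding triangulation of $\mathcal C_{I_n}$ is the simplicial complex on the set of variables (that is, of the corresponding points) whose Stanley–Reisner ideal is the radical of the initial ideal of the toric ideal; its facets are its inclusion-maximal faces. For a set $S$ of variables let $G_S$ be the following drawing of the path: vertex $i$ is white if $z_i\in S$ and black otherwise; the edge $\{i,i+1\}$ carries a line $-$ if $z_{i\,i+1}\in S$, a wavy line if $t_{i\,i+1}\in S$, an arrow $\rightarrow$ if $y_{i\,i+1}\in S$, and an arrow $\leftarrow$ if $y_{i+1\,i}\in S$. An edge is *single* if it carries exactly one symbol. It is *double with a $\leftarrow$* (*with a $\rightarrow$*) if it carries exactly the two symbols $-$ and $\leftarrow$ (exactly $-$ and $\rightarrow$). **Theorem.** Let $S$ be a set of variables of $R_{I_n}$, and let $i_1<\cdots<i_k$ be the white vertices of $G_S$. Then $S$ is a facet of this triangulation if and only if $k\ge 1$ and the following three conditions hold. 1. All edges between vertices of $\{1,\dots,i_1\}$ are double with a $\leftarrow$. 2. For every $j\in[k-1]$, the part of $G_S$ on $\{i_j,i_j+1,\dots,i_{j+1}\}$ has one of the following four forms: - (a), (b): there is an edge of this part, other than its leftmost edge, that is single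 and is a wavy line (form (a)) or a $\leftarrow$ (form (b)); all edges of the part to the right of it are double with a $\leftarrow$; the leftmost edge of the part is double with a $\rightarrow$; and each edge strictly between the leftmost edge and the single edge is double with a $\leftarrow$ or double with a $\rightarrow$; - (c), (d): the leftmost edge is single and is a wavy line (form (c)) or a line $-$ (form (d)); all other edges of the part are double with a $\leftarrow$. 3. Every edge between vertices of $\{i_k,i_k+1,\dots,n+1\}$ is double with a $\leftarrow$ or double with a $\rightarrow$, and the first one, $\{i_k,i_k+1\}$ (if $i_k\le n$), is double with a $\rightarrow$. -/

import Mathlib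

/-! ### Toric ideals, initial ideals and the associated regular triangulations -/

namespace ToricTriangulation

variable {σ κ : Type*}

/-- The toric ideal of a configuration `a` of integer points labelled by `σ`: the kernel of the
homomorphism of `K`-algebras from the polynomial ring on `σ` to the ring of Laurent polynomials
(the group algebra of `κ → ℤ`) sending the variable `v` to the Laurent monomial `w ^ (a v)`. -/
noncomputable def toricIdeal (K : Type*) [Field K] (a : σ → κ → ℤ) : Ideal (MvPolynomial σ K) :=
  RingHom.ker
    (MvPolynomial.aeval (R := K)
      (fun v => (AddMonoidAlgebra.single (a v) 1 : AddMonoidAlgebra K (κ → ℤ))))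

/-- The initial ideal of `I` for the monomial order `m`, generated by the leading terms of the
elements of `I`. -/
noncomputable def initialIdeal {K : Type*} [Field K] (m : MonomialOrder σ)
    (I : Ideal (MvPolynomial σ K)) : Ideal (MvPolynomial σ K) :=
  Ideal.span (m.leadingTerm '' (I : Set (MvPolynomial σ K)))

/-- The faces of the regular triangulation of a point configuration `a` that corresponds to a
monomial order: the simplicial complex, on the labels of the points, whose Stanley-Reisner ideal is
the radical of the initial ideal of the toric ideal of `a`. -/
def IsFace (K : Type*) [Field K] (m : MonomialOrder σ) (a : σ → κ → ℤ) (S : Finset σ) : Prop :=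
  (∏ v ∈ S, (MvPolynomial.X v : MvPolynomial σ K)) ∉ (initialIdeal m (toricIdeal K a)).radical

/-- The facets of that triangulation are its inclusion-maximal faces. -/
def IsFacet (K : Type*) [Field K] (m : MonomialOrder σ) (a : σ → κ → ℤ) (S : Finset σ) : Prop :=
  Maximal (IsFace K m a) S

end ToricTriangulation

/-! ### The cosmological polytope of the path

The path has the vertices `Fin (n + 1)` and the edges `Fin n`, where the edge `e` joins the vertices
`e.castSucc` (on the left) and `e.succ` (on the right). -/

namespace CosmologicalPath

/-- The four symbols that an edge can carry in the drawing of a set of variables. -/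
inductive EdgeSymbol : Type
  /-- a plain line, standing for `z_e` -/
  | line
  /-- a wavy line, standing for `t_e` -/
  | wave
  /-- an arrow `→` from the left end of `e` to its right end, standing for `y_{i,i+1}` -/
  | right
  /-- an arrow `←` from the right end of `e` to its left end, standing for `y_{i+1,i}` -/
  | left

/-- The variables of the polynomial ring of the path. -/
inductive PathVar (n : ℕ) : Type
  /-- the variable `z_i` of the vertex `i` -/
  | vert (i : Fin (n + 1))
  /-- the variable of the edge `e` that is drawn as the symbol `s` -/
  | edge (s : EdgeSymbol) (e : Fin n)

variable {n : ℕ}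

/-- The basis vector `x_i` of a vertex. -/
def vertVec (i : Fin (n + 1)) : Fin (n + 1) ⊕ Fin n → ℤ := Pi.single (Sum.inl i) 1

/-- The basis vector `x_e` of an edge. -/
def edgeVec (e : Fin n) : Fin (n + 1) ⊕ Fin n → ℤ := Pi.single (Sum.inr e) 1

/-- The lattice point that belongs to a variable. -/
def point : PathVar n → Fin (n + 1) ⊕ Fin n → ℤ
  | .vert i => vertVec i
  | .edge .line e => edgeVec e
  | .edge .wave e => vertVec e.castSucc + vertVec e.succ - edgeVec e
  | .edge .right e => vertVec e.castSucc - vertVec e.succ + edgeVec e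
  | .edge .left e => - vertVec e.castSucc + vertVec e.succ + edgeVec e

/-- A lattice point, as a point of real space. -/
def toReal (p : Fin (n + 1) ⊕ Fin n → ℤ) : Fin (n + 1) ⊕ Fin n → ℝ := fun k => (p k : ℝ)

/-- The cosmological polytope of the path. -/
def polytope (n : ℕ) : Set (Fin (n + 1) ⊕ Fin n → ℝ) :=
  convexHull ℝ
    {q | ∃ e : Fin n,
      q = toReal (vertVec e.castSucc + vertVec e.succ - edgeVec e) ∨
      q = toReal (vertVec e.castSucc - vertVec e.succ + edgeVec e) ∨
      q = toReal (- vertVec e.castSucc + vertVec e.succ + edgeVec e)}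

/-- The polytope is the convex hull of the points of all variables, so that a triangulation of that
configuration is a triangulation of the polytope. -/
theorem convexHull_range_point (hn : 1 ≤ n) :
    convexHull ℝ (Set.range fun v : PathVar n => toReal (point v)) = polytope n := by
  have hw : ∀ e : Fin n, toReal (point (.edge .wave e)) ∈ polytope n := fun e =>
    subset_convexHull ℝ _ ⟨e, Or.inl rfl⟩
  have hr : ∀ e : Fin n, toReal (point (.edge .right e)) ∈ polytope n := fun e =>
    subset_convexHull ℝ _ ⟨e, Or.inr (Or.inl rfl)⟩
  have hl : ∀ e : Fin n, toReal (point (.edge .left e)) ∈ polytope n := fun e =>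
    subset_convexHull ℝ _ ⟨e, Or.inr (Or.inr rfl)⟩
  have mid : ∀ x y z : Fin (n + 1) ⊕ Fin n → ℝ, x ∈ polytope n → y ∈ polytope n →
      z = (1 / 2 : ℝ) • x + (1 / 2 : ℝ) • y → z ∈ polytope n := by
    rintro x y z hx hy rfl
    exact convex_convexHull ℝ _ hx hy (by norm_num) (by norm_num) (by norm_num)
  apply Set.Subset.antisymm
  · refine convexHull_min ?_ (convex_convexHull ℝ _)
    rintro _ ⟨v, rfl⟩
    rcases v with i | ⟨s, e⟩
    · rcases Fin.eq_castSucc_or_eq_last i with ⟨e, rfl⟩ | rfl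
      · refine mid _ _ _ (hw e) (hr e) ?_
        ext k; simp only [toReal, point, Pi.add_apply, Pi.sub_apply, Pi.smul_apply, smul_eq_mul]
        push_cast; ring
      · obtain ⟨m, rfl⟩ : ∃ m, n = m + 1 := ⟨n - 1, by omega⟩
        refine mid _ _ _ (hw (Fin.last m)) (hl (Fin.last m)) ?_
        ext k
        simp only [toReal, point, Pi.add_apply, Pi.sub_apply, Pi.neg_apply, Pi.smul_apply,
          smul_eq_mul, Fin.succ_last]
        push_cast; ring
    · cases s
      · refine mid _ _ _ (hr e) (hl e) ?_
        ext k
        simp only [toReal, point, Pi.add_apply, Pi.sub_apply, Pi.neg_apply, Pi.smul_apply,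
          smul_eq_mul]
        push_cast; ring
      · exact hw e
      · exact hr e
      · exact hl e
  · refine convexHull_mono ?_
    rintro q ⟨e, rfl | rfl | rfl⟩
    · exact ⟨.edge .wave e, rfl⟩
    · exact ⟨.edge .right e, rfl⟩
    · exact ⟨.edge .left e, rfl⟩

/-- The position of a variable in the list
`y_{12}, …, y_{n,n+1}, y_{n+1,n}, …, y_{21}, z_{12}, …, z_{n,n+1}, t_{12}, …, t_{n,n+1},
z_1, …, z_{n+1}`, which starts with the largest variable. -/
def rank : PathVar n → ℕ
  | .edge .right e => e
  | .edge .left e => n + (n - 1 - e)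
  | .edge .line e => 2 * n + e
  | .edge .wave e => 3 * n + e
  | .vert i => 4 * n + i

theorem rank_injective : Function.Injective (rank (n := n)) := by
  rintro (i | ⟨s, e⟩) (j | ⟨s', e'⟩) h
  · have : i = j := by ext; simp only [rank] at h; omega
    rw [this]
  · cases s' <;> simp only [rank] at h <;> omega
  · cases s <;> simp only [rank] at h <;> omega
  · have : s = s' ∧ e = e' := by
      cases s <;> cases s' <;> simp only [rank] at h <;>
        first
          | exact ⟨rfl, by ext; omega⟩
          | (exfalso; omega)
    rw [this.1, this.2]

theorem rank_lt (v : PathVar n) : rank v < 5 * n + 1 := by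
  rcases v with i | ⟨s, e⟩
  · simp only [rank]; omega
  · cases s <;> simp only [rank] <;> omega

instance : Finite (PathVar n) :=
  Finite.of_injective (fun v => (⟨rank v, rank_lt v⟩ : Fin (5 * n + 1)))
    (fun _ _ h => rank_injective (Fin.mk.inj h))

/-- The variables are linearly ordered by their position. Mathlib's lexicographic monomial order
compares the exponents of the least element first, so that there `X v > X w` holds
if and only if `v < w`. -/
noncomputable instance : LinearOrder (PathVar n) := LinearOrder.lift' rank rank_injective

/-- `S` is a facet of the triangulation of the cosmological polytope of the path that corresponds
to the lexicographic order. -/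
def IsPathFacet (K : Type*) [Field K] (S : Finset (PathVar n)) : Prop :=
  ToricTriangulation.IsFacet K MonomialOrder.lex point S

/-! ### The graph `G_S` that represents a set `S` of variables -/

/-- The vertex `i` is drawn white. -/
def IsWhite (S : Finset (PathVar n)) (i : Fin (n + 1)) : Prop := PathVar.vert i ∈ S

/-- The set of symbols carried by the edge `e` in the drawing of `S`. -/
def symbols (S : Finset (PathVar n)) (e : Fin n) : Set EdgeSymbol := {s | PathVar.edge s e ∈ S}

/-- `e` is drawn as a double edge with a `←`. -/
def DoubleLeft (S : Finset (PathVar n)) (e : Fin n) : Prop :=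
  symbols S e = {EdgeSymbol.line, EdgeSymbol.left}

/-- `e` is drawn as a double edge with a `→`. -/
def DoubleRight (S : Finset (PathVar n)) (e : Fin n) : Prop :=
  symbols S e = {EdgeSymbol.line, EdgeSymbol.right}

/-- `e` is drawn as a single edge, with the symbol `s`. -/
def Single (S : Finset (PathVar n)) (s : EdgeSymbol) (e : Fin n) : Prop :=
  symbols S e = {s}

/-- The edge `e` belongs to the induced subgraph on the vertices from `a` to `b`. -/
def Between (a b : Fin (n + 1)) (e : Fin n) : Prop := a ≤ e.castSucc ∧ e.succ ≤ b

/-- `a < b` are consecutive white vertices. -/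
def ConsecutiveWhite (S : Finset (PathVar n)) (a b : Fin (n + 1)) : Prop :=
  a < b ∧ IsWhite S a ∧ IsWhite S b ∧ ∀ c, a < c → c < b → ¬ IsWhite S c

/-- Between `a` and `b`, some edge `e` whose left end is not `a` is single with the symbol `s`, all
edges to the right of `e` are double with a `←`, and all edges to the left of `e` are double with
either arrow, except for the first one, which has a `→`. -/
def InnerForm (S : Finset (PathVar n)) (s : EdgeSymbol) (a b : Fin (n + 1)) : Prop :=
  ∃ e, Between a b e ∧ a < e.castSucc ∧ Single S s e ∧
    ∀ f, Between a b f →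
      (e < f → DoubleLeft S f) ∧
      (f < e → a = f.castSucc → DoubleRight S f) ∧
      (f < e → a < f.castSucc → DoubleLeft S f ∨ DoubleRight S f)

/-- Between `a` and `b`, the leftmost edge is single with the symbol `s` and all other edges are
double with a `←`. -/
def FirstForm (S : Finset (PathVar n)) (s : EdgeSymbol) (a b : Fin (n + 1)) : Prop :=
  ∀ f, Between a b f →
    (a = f.castSucc → Single S s f) ∧ (a < f.castSucc → DoubleLeft S f)

/-- The part of the drawing to the left of the first white vertex `a`. -/
def LeftPart (S : Finset (PathVar n)) (a : Fin (n + 1)) : Prop :=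
  ∀ e : Fin n, e.succ ≤ a → DoubleLeft S e

/-- The part of the drawing to the right of the last white vertex `b`. -/
def RightPart (S : Finset (PathVar n)) (b : Fin (n + 1)) : Prop :=
  ∀ e : Fin n,
    (b = e.castSucc → DoubleRight S e) ∧ (b < e.castSucc → DoubleLeft S e ∨ DoubleRight S e)

end CosmologicalPath

/-! ### Faces of a triangulation through fibres of monomials, and a weight criterion for
lexicographic orders -/

namespace ToricTriangulation

variable {σ κ : Type*}

open Finsupp (linearCombination)

/-! The toric ideal is spanned by differences of monomials with the same image, so `S` is a face
exactly when every monomial supported in `S` is minimal in its fibre (`isFace_iff`). For the path,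
an explicit list of leading monomials decides this. At an edge `e = {i,i+1}`, the forbidden pairs
are `→` with `←`, a wave with any other symbol, and `←` with a white left end. In addition, no `→`
may be joined to a white vertex further right by a path of edges that carry `→` or a line. `Avoids`
collects these conditions. Each is necessary because of an explicit relation. They suffice because
every variable of `S` then has a weight functional that is negative on it, nonnegative on all
smaller variables, and zero on those of them in `S` (`isFace_iff_avoids`). No Gröbner basis is
computed.

The long-range condition is recorded as the existence of a separating set of vertices: it contains
the heads of the arrows `→`, is carried rightwards by lines, and misses the white vertices. The
smallest such set consists of the active vertices, the largest of those from which no white vertex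
is reached along lines. In a maximal `S` they agree, and with this set given, maximality is a
condition on single edges (`LocalRules`, `isPathFacet_iff_localRules`).

The local rules are a left-to-right automaton with states white, active, and black inactive. The
path starts outside the active set; an active stretch can begin only right after a white vertex;
once inactive, a vertex stays so until the next white one; the last vertex is white or active.
Reading off the possible runs gives the stated shapes (`LocalRules.consecutiveWhite`). Conversely,
`AfterDoubles` recovers the active set from a drawing of these shapes. -/

theorem aeval_single_monomial {K : Type*} [Field K] (a : σ → κ → ℤ) (d : σ →₀ ℕ) (c : K) :
    MvPolynomial.aeval (R := K)
      (fun v => (AddMonoidAlgebra.single (a v) 1 : AddMonoidAlgebra K (κ → ℤ)))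
      (MvPolynomial.monomial d c) = AddMonoidAlgebra.single (linearCombination ℕ a d) c := by
  have h : ∀ d : σ →₀ ℕ, (d.prod fun v k =>
      (AddMonoidAlgebra.single (a v) 1 : AddMonoidAlgebra K (κ → ℤ)) ^ k) =
        AddMonoidAlgebra.single (linearCombination ℕ a d) 1 := by
    intro d
    induction d using Finsupp.induction_linear with
    | zero => simp [AddMonoidAlgebra.one_def]
    | add f g hf hg =>
      rw [Finsupp.prod_add_index' (by simp) (by intros; rw [pow_add]), hf, hg, map_add,
        AddMonoidAlgebra.single_mul_single, one_mul]
    | single v k => simp [AddMonoidAlgebra.single_pow]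
  rw [MvPolynomial.aeval_monomial, h, ← Algebra.smul_def, AddMonoidAlgebra.smul_single,
    smul_eq_mul, mul_one]

theorem binomial_mem_toricIdeal (K : Type*) [Field K] {a : σ → κ → ℤ} {u v : σ →₀ ℕ}
    (h : linearCombination ℕ a u = linearCombination ℕ a v) :
    MvPolynomial.monomial u (1 : K) - MvPolynomial.monomial v 1 ∈ toricIdeal K a := by
  rw [toricIdeal, RingHom.mem_ker, map_sub, aeval_single_monomial, aeval_single_monomial, h,
    sub_self]

/-- If `d` were alone in its fibre, nothing could cancel its coefficient in the image of `f`. -/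
theorem exists_ne_of_mem_toricIdeal {K : Type*} [Field K] {a : σ → κ → ℤ}
    {f : MvPolynomial σ K} (hf : f ∈ toricIdeal K a) {d : σ →₀ ℕ} (hd : d ∈ f.support) :
    ∃ e ∈ f.support, e ≠ d ∧ linearCombination ℕ a e = linearCombination ℕ a d := by
  classical
  by_contra! H
  rw [toricIdeal, RingHom.mem_ker, f.as_sum, map_sum] at hf
  simp only [aeval_single_monomial] at hf
  have h := congrArg (fun x : AddMonoidAlgebra K (κ → ℤ) => x.coeff (linearCombination ℕ a d)) hf
  simp only [AddMonoidAlgebra.coeff_sum, Finsupp.finsetSum_apply] at h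
  rw [Finset.sum_eq_single_of_mem d hd] at h
  · simp at h
    simp [h] at hd
  · intro e he hne
    simp [H e he hne]

/-- The faces are the sets all of whose monomials are minimal in their fibre. -/
theorem isFace_iff (K : Type*) [Field K] (m : MonomialOrder σ) (a : σ → κ → ℤ) (S : Finset σ) :
    IsFace K m a S ↔ ∀ u v : σ →₀ ℕ, u.support ⊆ S →
      linearCombination ℕ a u = linearCombination ℕ a v → ¬ m.toSyn v < m.toSyn u := by
  classical
  constructor
  · intro hS u v hu huv hlt
    apply hS
    have hdeg : m.toSyn (m.degree (MvPolynomial.monomial v (1 : K))) <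
        m.toSyn (m.degree (MvPolynomial.monomial u (1 : K))) := by
      simpa [MonomialOrder.degree_monomial] using hlt
    have hmem : MvPolynomial.monomial u (1 : K) ∈ initialIdeal m (toricIdeal K a) := by
      refine Ideal.subset_span ⟨_, binomial_mem_toricIdeal K huv, ?_⟩
      rw [MonomialOrder.leadingTerm, m.degree_sub_of_lt hdeg, m.leadingCoeff_sub_of_lt hdeg]
      simp [MonomialOrder.degree_monomial]
    -- A common bound on the exponents of `u`: the monomial `u` then divides the `N`-th power of the
    -- squarefree monomial of `S`, which puts the latter in the radical.
    obtain ⟨N, hN⟩ : ∃ N, ∀ x, u x ≤ N := by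
      refine ⟨u.support.sup u, fun x => ?_⟩
      by_cases hx : x ∈ u.support
      · exact Finset.le_sup hx
      · simp [Finsupp.notMem_support_iff.1 hx]
    refine ⟨N, ?_⟩
    refine Ideal.mem_of_dvd _ ?_ hmem
    rw [MvPolynomial.monomial_eq, map_one, one_mul, Finsupp.prod_of_support_subset _ hu _ (by simp),
      ← Finset.prod_pow]
    exact Finset.prod_dvd_prod_of_dvd _ _ fun x _ => pow_dvd_pow _ (hN x)
  · rintro h ⟨N, hN⟩
    -- Leading terms are scalar multiples of leading monomials, so the initial ideal lies in a
    -- monomial ideal, where membership is divisibility by a generator.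
    have hle : initialIdeal m (toricIdeal K a) ≤ Ideal.span ((fun s => MvPolynomial.monomial s (1 : K)) ''
        {d | ∃ f ∈ toricIdeal K a, f ≠ 0 ∧ m.degree f = d}) := by
      refine Ideal.span_le.2 ?_
      rintro _ ⟨f, hf, rfl⟩
      by_cases h0 : f = 0
      · simp [h0]
      · refine Ideal.mem_of_dvd _ ?_ (Ideal.subset_span ⟨_, ⟨f, hf, h0, rfl⟩, rfl⟩)
        refine ⟨MvPolynomial.C (m.leadingCoeff f), ?_⟩
        rw [mul_comm, MvPolynomial.C_mul_monomial, mul_one, MonomialOrder.leadingTerm]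
    have hmon : (∏ v ∈ S, (MvPolynomial.X v : MvPolynomial σ K)) ^ N =
        MvPolynomial.monomial (∑ v ∈ S, Finsupp.single v N) 1 := by
      rw [← Finset.prod_pow, MvPolynomial.monomial_sum_one]
      exact Finset.prod_congr rfl fun v _ => MvPolynomial.X_pow_eq_monomial
    rw [hmon] at hN
    obtain ⟨_, ⟨f, hf, h0, rfl⟩, hd⟩ := MvPolynomial.mem_ideal_span_monomial_image.1 (hle hN)
      (∑ v ∈ S, Finsupp.single v N) (by simp [MvPolynomial.mem_support_iff])
    obtain ⟨e, he, hne, hA⟩ := exists_ne_of_mem_toricIdeal hf (m.degree_mem_support h0)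
    refine h (m.degree f) e ?_ hA.symm ?_
    · intro x hx
      by_contra hxS
      have h1 := hd x
      rw [Finsupp.finsetSum_apply, Finset.sum_eq_zero] at h1
      · exact Finsupp.mem_support_iff.1 hx (by omega)
      · intro v hv
        exact Finsupp.single_eq_of_ne (by rintro rfl; exact hxS hv)
    · exact lt_of_le_of_ne (m.le_degree he) fun h => hne (m.toSyn.injective h)

theorem dotProduct_linearCombination [Fintype κ] (a : σ → κ → ℤ) (c : κ → ℤ) (u : σ →₀ ℕ) :
    c ⬝ᵥ linearCombination ℕ a u = u.sum fun x k => (k : ℤ) * (c ⬝ᵥ a x) := by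
  rw [Finsupp.linearCombination_apply, Finsupp.sum, dotProduct_sum, Finsupp.sum]
  exact Finset.sum_congr rfl fun x _ => by rw [dotProduct_smul]; simp

/-- A certificate for faces of lexicographic triangulations: for every `w ∈ S` a functional that is
negative at `w`, nonnegative at all later points and zero at the later points of `S`. -/
theorem isFace_lex_of_forall_exists (K : Type*) [Field K] [LinearOrder σ] [Finite σ] [Fintype κ]
    {a : σ → κ → ℤ} {S : Finset σ}
    (h : ∀ w ∈ S, ∃ c : κ → ℤ, c ⬝ᵥ a w < 0 ∧
      ∀ x, w < x → 0 ≤ c ⬝ᵥ a x ∧ (x ∈ S → c ⬝ᵥ a x = 0)) :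
    IsFace K MonomialOrder.lex a S := by
  have := Fintype.ofFinite σ
  rw [isFace_iff]
  intro u v hu huv hlt
  obtain ⟨w, hw, hlt⟩ := Finsupp.Lex.lt_iff.1 (MonomialOrder.lex_lt_iff.1 hlt)
  simp only [ofLex_toLex] at hw hlt
  have hwS : w ∈ S := hu (Finsupp.mem_support_iff.2 (by omega))
  obtain ⟨c, hc, hx⟩ := h w hwS
  have heq := congrArg (fun p => c ⬝ᵥ p) huv
  simp only [dotProduct_linearCombination] at heq
  rw [Finsupp.sum_fintype _ _ (by simp), Finsupp.sum_fintype _ _ (by simp)] at heq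
  -- The two sums agree before the first difference `w`. At `w` the larger exponent of `u` meets a
  -- negative weight, and after `w` the terms of `u` vanish while those of `v` are nonnegative. So
  -- the total for `u` is strictly smaller.
  refine (Finset.sum_lt_sum (fun x _ => ?_) ⟨w, Finset.mem_univ w, ?_⟩).ne heq
  · rcases lt_trichotomy x w with h1 | rfl | h1
    · rw [hw x h1]
    · exact mul_le_mul_of_nonpos_right (by exact_mod_cast hlt.le) hc.le
    · by_cases hxS : x ∈ S
      · simp [(hx x h1).2 hxS]
      · have : u x = 0 := by
          by_contra h0
          exact hxS (hu (Finsupp.mem_support_iff.2 h0))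
        rw [this]
        simpa using mul_nonneg (Int.natCast_nonneg (v x)) (hx x h1).1
  · exact mul_lt_mul_of_neg_right (by exact_mod_cast hlt) hc

end ToricTriangulation

namespace CosmologicalPath

variable {n : ℕ}

open Finsupp (linearCombination)
open ToricTriangulation

/-! ### Combinatorial description of the faces -/

/-- The vertex `i` is reached from the right end of `e`, rightwards along edges that carry a line or
an arrow `→`. -/
inductive Chain (S : Finset (PathVar n)) (e : Fin n) : Fin (n + 1) → Prop
  | start : Chain S e e.succ
  | step (f : Fin n) (hf : PathVar.edge .line f ∈ S ∨ PathVar.edge .right f ∈ S)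
      (h : Chain S e f.castSucc) : Chain S e f.succ

/-- The vertex `i` is reached from the left end of `e`, leftwards along edges that carry an
arrow `←`. -/
inductive LeftChain (S : Finset (PathVar n)) (e : Fin n) : Fin (n + 1) → Prop
  | start : LeftChain S e e.castSucc
  | step (f : Fin n) (hf : PathVar.edge .left f ∈ S)
      (h : LeftChain S e f.succ) : LeftChain S e f.castSucc

theorem chain_succ_iff {S : Finset (PathVar n)} {e f : Fin n} :
    Chain S e f.succ ↔ f = e ∨
      Chain S e f.castSucc ∧ (PathVar.edge .line f ∈ S ∨ PathVar.edge .right f ∈ S) := by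
  constructor
  · intro h
    generalize hi : f.succ = i at h
    cases h with
    | start => exact Or.inl (Fin.succ_inj.1 hi)
    | step g hg h => obtain rfl := Fin.succ_inj.1 hi; exact Or.inr ⟨h, hg⟩
  · rintro (rfl | ⟨h, hf⟩)
    · exact .start
    · exact .step f hf h

theorem leftChain_castSucc_iff {S : Finset (PathVar n)} {e f : Fin n} :
    LeftChain S e f.castSucc ↔ f = e ∨ LeftChain S e f.succ ∧ PathVar.edge .left f ∈ S := by
  constructor
  · intro h
    generalize hi : f.castSucc = i at h
    cases h with
    | start => exact Or.inl (Fin.castSucc_inj.1 hi)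
    | step g hg h => obtain rfl := Fin.castSucc_inj.1 hi; exact Or.inr ⟨h, hg⟩
  · rintro (rfl | ⟨h, hf⟩)
    · exact .start
    · exact .step f hf h

theorem Chain.lt {S : Finset (PathVar n)} {e : Fin n} {i : Fin (n + 1)} (h : Chain S e i) :
    e.castSucc < i := by
  induction h with
  | start => exact Fin.castSucc_lt_succ
  | step f _ _ ih => exact ih.trans Fin.castSucc_lt_succ

theorem LeftChain.le {S : Finset (PathVar n)} {e : Fin n} {i : Fin (n + 1)}
    (h : LeftChain S e i) : i ≤ e.castSucc := by
  induction h with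
  | start => exact le_rfl
  | step f _ _ ih => exact Fin.castSucc_lt_succ.le.trans ih

/-- A set of vertices that contains the right ends of all arrows `→`, contains with the left end of
a line also its right end, and contains no white vertex. -/
structure IsSeparating (S : Finset (PathVar n)) (A : Fin (n + 1) → Prop) : Prop where
  right : ∀ e, PathVar.edge .right e ∈ S → A e.succ
  line : ∀ e, PathVar.edge .line e ∈ S → A e.castSucc → A e.succ
  white : ∀ i, PathVar.vert i ∈ S → ¬ A i

/-- The sets of variables that contain no leading monomial of a relation. -/
structure Avoids (S : Finset (PathVar n)) : Prop where
  arrows : ∀ e, PathVar.edge .right e ∈ S → PathVar.edge .left e ∉ S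
  wave : ∀ e s, PathVar.edge .wave e ∈ S → PathVar.edge s e ∈ S → s = .wave
  left : ∀ e, PathVar.edge .left e ∈ S → PathVar.vert e.castSucc ∉ S
  separating : ∃ A, IsSeparating S A

/-- Chains that start at arrows `→` of `S` stay in every separating set; this makes the active
vertices the smallest one. -/
theorem IsSeparating.of_chain {S : Finset (PathVar n)} {A : Fin (n + 1) → Prop}
    (hA : IsSeparating S A) {e : Fin n} (he : PathVar.edge .right e ∈ S) {i : Fin (n + 1)}
    (h : Chain S e i) : A i := by
  induction h with
  | start => exact hA.right e he
  | step f hf _ ih => exact hf.elim (fun hf => hA.line f hf ih) fun hf => hA.right f hf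

theorem lt_iff_rank_lt {v w : PathVar n} : v < w ↔ rank v < rank w := Iff.rfl

/-! ### Weight functionals certifying that a set is a face -/

section Functional

variable (φ : Fin (n + 1) → ℤ) (ψ : Fin n → ℤ)

theorem elim_dotProduct_vert (i : Fin (n + 1)) :
    Sum.elim φ ψ ⬝ᵥ point (.vert i) = φ i := by
  simp [point, vertVec]

theorem elim_dotProduct_line (e : Fin n) :
    Sum.elim φ ψ ⬝ᵥ point (.edge .line e) = ψ e := by
  simp [point, edgeVec]

theorem elim_dotProduct_wave (e : Fin n) :
    Sum.elim φ ψ ⬝ᵥ point (.edge .wave e) = φ e.castSucc + φ e.succ - ψ e := by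
  simp [point, edgeVec, vertVec, dotProduct_add, dotProduct_sub]

theorem elim_dotProduct_right (e : Fin n) :
    Sum.elim φ ψ ⬝ᵥ point (.edge .right e) = φ e.castSucc - φ e.succ + ψ e := by
  simp [point, edgeVec, vertVec, dotProduct_add, dotProduct_sub]

theorem elim_dotProduct_left (e : Fin n) :
    Sum.elim φ ψ ⬝ᵥ point (.edge .left e) = - φ e.castSucc + φ e.succ + ψ e := by
  simp [point, edgeVec, vertVec, dotProduct_add, dotProduct_neg]

end Functional

theorem exists_functional_vert (S : Finset (PathVar n)) (i : Fin (n + 1)) :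
    ∃ c : Fin (n + 1) ⊕ Fin n → ℤ, c ⬝ᵥ point (.vert i) < 0 ∧
      ∀ x, PathVar.vert i < x → 0 ≤ c ⬝ᵥ point x ∧ (x ∈ S → c ⬝ᵥ point x = 0) := by
  refine ⟨Sum.elim (fun j => if j = i then -1 else 0) 0, by simp [elim_dotProduct_vert], ?_⟩
  rintro (j | ⟨s, e⟩) hx
  · have : j ≠ i := by rintro rfl; exact lt_irrefl _ hx
    simp [elim_dotProduct_vert, this]
  · rw [lt_iff_rank_lt] at hx
    cases s <;> simp only [rank] at hx <;> omega

theorem exists_functional_wave (S : Finset (PathVar n)) (e : Fin n) :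
    ∃ c : Fin (n + 1) ⊕ Fin n → ℤ, c ⬝ᵥ point (.edge .wave e) < 0 ∧
      ∀ x, PathVar.edge .wave e < x → 0 ≤ c ⬝ᵥ point x ∧ (x ∈ S → c ⬝ᵥ point x = 0) := by
  refine ⟨Sum.elim 0 (fun f => if f = e then 1 else 0), by simp [elim_dotProduct_wave], ?_⟩
  rintro (j | ⟨s, f⟩) hx
  · simp [elim_dotProduct_vert]
  · rw [lt_iff_rank_lt] at hx
    cases s <;> simp only [rank] at hx <;> try omega
    have : f ≠ e := by rintro rfl; exact lt_irrefl _ hx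
    simp [elim_dotProduct_wave, this]

theorem Avoids.exists_functional_line {S : Finset (PathVar n)} (hS : Avoids S) {e : Fin n}
    (he : PathVar.edge .line e ∈ S) :
    ∃ c : Fin (n + 1) ⊕ Fin n → ℤ, c ⬝ᵥ point (.edge .line e) < 0 ∧
      ∀ x, PathVar.edge .line e < x → 0 ≤ c ⬝ᵥ point x ∧ (x ∈ S → c ⬝ᵥ point x = 0) := by
  refine ⟨Sum.elim 0 (fun f => if f = e then -1 else 0), by simp [elim_dotProduct_line], ?_⟩
  rintro (j | ⟨s, f⟩) hx
  · simp [elim_dotProduct_vert]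
  · rw [lt_iff_rank_lt] at hx
    cases s <;> simp only [rank] at hx <;> try omega
    · have : f ≠ e := by rintro rfl; exact lt_irrefl _ hx
      simp [elim_dotProduct_line, this]
    · rw [elim_dotProduct_wave]
      split_ifs with h
      · subst h
        exact ⟨by simp, fun h => nomatch hS.wave f .line h he⟩
      · simp

open Classical in
-- Give weight 1 to the vertices of the left chain, so that `←` on `e` gets -1. Arrows of `S` inside
-- the chain cancel, and the chain has no white vertex. The edge weight 1 on a wave of `S` entered
-- from the chain brings that wave back to 0; such an edge carries neither a line nor `←`.
theorem Avoids.exists_functional_left {S : Finset (PathVar n)} (hS : Avoids S) {e : Fin n}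
    (he : PathVar.edge .left e ∈ S) :
    ∃ c : Fin (n + 1) ⊕ Fin n → ℤ, c ⬝ᵥ point (.edge .left e) < 0 ∧
      ∀ x, PathVar.edge .left e < x → 0 ≤ c ⬝ᵥ point x ∧ (x ∈ S → c ⬝ᵥ point x = 0) := by
  have hblack : ∀ i, PathVar.vert i ∈ S → ¬ LeftChain S e i := by
    rintro _ hi (_ | ⟨f, hf, h⟩)
    · exact hS.left e he hi
    · exact hS.left f hf hi
  have hwave : ∀ f, PathVar.edge .wave f ∈ S → PathVar.edge .left f ∉ S :=
    fun f h1 h2 => nomatch hS.wave f .left h1 h2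
  have hend : ¬ LeftChain S e e.succ := fun h => h.le.not_gt Fin.castSucc_lt_succ
  refine ⟨Sum.elim (fun i => if LeftChain S e i then 1 else 0)
    (fun f => if PathVar.edge .wave f ∈ S ∧ LeftChain S e f.succ then 1 else 0), ?_, ?_⟩
  · rw [elim_dotProduct_left, if_pos .start, if_neg hend, if_neg fun h => hend h.2]
    simp
  rintro (i | ⟨s, f⟩) hx
  · rw [elim_dotProduct_vert]
    specialize hblack i
    grind
  · rw [lt_iff_rank_lt] at hx
    have hcs := leftChain_castSucc_iff (S := S) (e := e) (f := f)
    specialize hwave f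
    cases s
    · rw [elim_dotProduct_line]
      have := hS.wave f .line
      grind
    · rw [elim_dotProduct_wave]
      grind
    · simp only [rank] at hx
      omega
    · have hfe : f ≠ e := by rintro rfl; exact lt_irrefl _ hx
      rw [elim_dotProduct_left]
      grind

open Classical in
-- Give weight 1 to the vertices of the chain, which are black by separation, so that `→` on `e`
-- gets -1. The edge by which the chain ends also gets weight 1, which keeps its `←` and its wave at
-- 0. Its line and its `→` become positive, but neither is in `S`, for otherwise the chain would
-- continue.
theorem Avoids.exists_functional_right {S : Finset (PathVar n)} (hS : Avoids S) {e : Fin n}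
    (he : PathVar.edge .right e ∈ S) :
    ∃ c : Fin (n + 1) ⊕ Fin n → ℤ, c ⬝ᵥ point (.edge .right e) < 0 ∧
      ∀ x, PathVar.edge .right e < x → 0 ≤ c ⬝ᵥ point x ∧ (x ∈ S → c ⬝ᵥ point x = 0) := by
  obtain ⟨A, hA⟩ := hS.separating
  have hblack : ∀ i, PathVar.vert i ∈ S → ¬ Chain S e i :=
    fun i hi h => hA.white i hi (hA.of_chain he h)
  have hstart : ¬ Chain S e e.castSucc := fun h => lt_irrefl _ h.lt
  refine ⟨Sum.elim (fun i => if Chain S e i then 1 else 0)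
    (fun f => if Chain S e f.castSucc ∧ ¬ Chain S e f.succ then 1 else 0), ?_, ?_⟩
  · rw [elim_dotProduct_right, if_neg hstart, if_pos .start, if_neg fun h => hstart h.1]
    simp
  rintro (i | ⟨s, f⟩) hx
  · rw [elim_dotProduct_vert]
    specialize hblack i
    grind
  · have hcs := chain_succ_iff (S := S) (e := e) (f := f)
    have h1 := hS.arrows f
    have h2 := hS.wave f
    cases s
    · rw [elim_dotProduct_line]
      grind
    · rw [elim_dotProduct_wave]
      have := h2 .line
      have := h2 .right
      grind
    · have hfe : f ≠ e := by rintro rfl; exact lt_irrefl _ hx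
      rw [elim_dotProduct_right]
      grind
    · rw [elim_dotProduct_left]
      grind

/-! ### Relations whose leading monomials are forbidden -/

theorem toLex_lt_of_forall_lt {u v : PathVar n →₀ ℕ} {w : PathVar n} (hw : u w ≠ 0)
    (h : ∀ x, v x ≠ 0 → w < x) : toLex v < toLex u := by
  rcases lt_trichotomy (toLex v) (toLex u) with h1 | h1 | h1
  · exact h1
  · obtain rfl := toLex_inj.1 h1
    exact absurd (h w hw) (lt_irrefl w)
  · obtain ⟨i, hi, hlt⟩ := Finsupp.Lex.lt_iff.1 h1
    simp only [ofLex_toLex] at hi hlt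
    -- At the first difference `i` the exponent of `v` is the larger one, hence nonzero, so `w < i`.
    -- Then `u` and `v` agree at `w`, and `v` contains `w` itself.
    have hwi := h i (by omega)
    exact absurd (h w (hi w hwi ▸ hw)) (lt_irrefl w)

theorem not_isFace_of_relation {K : Type*} [Field K] {S : Finset (PathVar n)}
    {u v : PathVar n →₀ ℕ} (hu : ∀ x, u x ≠ 0 → x ∈ S)
    (huv : linearCombination ℕ point u = linearCombination ℕ point v) {w : PathVar n}
    (hw : u w ≠ 0) (h : ∀ x, v x ≠ 0 → w < x) : ¬ IsFace K MonomialOrder.lex point S := fun hS =>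
  (isFace_iff K _ _ S).1 hS u v (fun x hx => hu x (Finsupp.mem_support_iff.1 hx)) huv
    (toLex_lt_of_forall_lt hw h)

theorem single_add_apply_ne_zero {u : PathVar n →₀ ℕ} {y x : PathVar n} {k : ℕ}
    (h : (u + Finsupp.single y k) x ≠ 0) : u x ≠ 0 ∨ x = y := by
  by_contra! h1
  exact h (by simp [h1.1, Finsupp.single_eq_of_ne h1.2])

theorem not_isFace_of_quadratic {K : Type*} [Field K] {S : Finset (PathVar n)}
    {x y x' y' : PathVar n} (hx : x ∈ S) (hy : y ∈ S) (h1 : x < x') (h2 : x < y')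
    (h : point x + point y = point x' + point y') : ¬ IsFace K MonomialOrder.lex point S := by
  refine not_isFace_of_relation (u := Finsupp.single x 1 + Finsupp.single y 1)
    (v := Finsupp.single x' 1 + Finsupp.single y' 1) (w := x) ?_ (by simpa using h) (by simp) ?_
  · intro z hz
    rcases single_add_apply_ne_zero hz with h | rfl
    · rw [Finsupp.single_apply_ne_zero] at h
      exact h.1 ▸ hx
    · exact hy
  · intro z hz
    rcases single_add_apply_ne_zero hz with h | rfl
    · rw [Finsupp.single_apply_ne_zero] at h
      exact h.1 ▸ h1
    · exact h2

/-- Telescoping along the chain. Moving the vertex from the right to the left end of an edge turns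
its line into `←`, or its `→` into a line. Both new symbols are smaller variables than any `→`. -/
theorem Chain.exists_relation {S : Finset (PathVar n)} {e : Fin n} {i : Fin (n + 1)}
    (h : Chain S e i) : ∃ u v : PathVar n →₀ ℕ, (∀ x, u x ≠ 0 → x ∈ S) ∧
      (∀ x, v x ≠ 0 → PathVar.edge .right e < x) ∧
      linearCombination ℕ point u + point (.vert i) =
        linearCombination ℕ point v + point (.vert e.succ) := by
  induction h with
  | start => exact ⟨0, 0, by simp, by simp, rfl⟩
  | step f hf _ ih =>
    obtain ⟨u, v, hu, hv, h⟩ := ih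
    rcases hf with hf | hf
    · refine ⟨u + Finsupp.single (.edge .line f) 1, v + Finsupp.single (.edge .left f) 1,
        fun x hx => ?_, fun x hx => ?_, ?_⟩
      · rcases single_add_apply_ne_zero hx with hx | rfl
        exacts [hu x hx, hf]
      · rcases single_add_apply_ne_zero hx with hx | rfl
        · exact hv x hx
        · simp only [lt_iff_rank_lt, rank]; omega
      · simp only [map_add, Finsupp.linearCombination_single, one_smul]
        rw [add_right_comm, add_right_comm _ _ (point (.vert e.succ)), ← h]
        simp only [point]
        abel
    · refine ⟨u + Finsupp.single (.edge .right f) 1, v + Finsupp.single (.edge .line f) 1,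
        fun x hx => ?_, fun x hx => ?_, ?_⟩
      · rcases single_add_apply_ne_zero hx with hx | rfl
        exacts [hu x hx, hf]
      · rcases single_add_apply_ne_zero hx with hx | rfl
        · exact hv x hx
        · simp only [lt_iff_rank_lt, rank]; omega
      · simp only [map_add, Finsupp.linearCombination_single, one_smul]
        rw [add_right_comm, add_right_comm _ _ (point (.vert e.succ)), ← h]
        simp only [point]
        abel

/-- One more exchange moves the vertex across `e` and turns its `→` into a line. After it, every
variable on the other side is smaller than that `→`. -/
theorem not_isFace_of_chain {K : Type*} [Field K] {S : Finset (PathVar n)} {e : Fin n}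
    {i : Fin (n + 1)} (he : PathVar.edge .right e ∈ S) (h : Chain S e i)
    (hi : PathVar.vert i ∈ S) : ¬ IsFace K MonomialOrder.lex point S := by
  obtain ⟨u, v, hu, hv, h⟩ := h.exists_relation
  refine not_isFace_of_relation
    (u := u + Finsupp.single (.vert i) 1 + Finsupp.single (.edge .right e) 1)
    (v := v + Finsupp.single (.edge .line e) 1 + Finsupp.single (.vert e.castSucc) 1)
    (w := .edge .right e) (fun x hx => ?_) ?_ (by simp) fun x hx => ?_
  · rcases single_add_apply_ne_zero hx with hx | rfl
    · rcases single_add_apply_ne_zero hx with hx | rfl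
      exacts [hu x hx, hi]
    · exact he
  · simp only [map_add, Finsupp.linearCombination_single, one_smul, h]
    simp only [point]
    abel
  · rcases single_add_apply_ne_zero hx with hx | rfl
    · rcases single_add_apply_ne_zero hx with hx | rfl
      · exact hv x hx
      · simp only [lt_iff_rank_lt, rank]; omega
    · simp only [lt_iff_rank_lt, rank]; omega

/-- A vertex is active if it is reached from an arrow `→`. -/
def Active (S : Finset (PathVar n)) (i : Fin (n + 1)) : Prop :=
  ∃ e, PathVar.edge .right e ∈ S ∧ Chain S e i

theorem isFace_iff_avoids (K : Type*) [Field K] (S : Finset (PathVar n)) :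
    IsFace K MonomialOrder.lex point S ↔ Avoids S := by
  constructor
  · intro hS
    refine ⟨fun e h1 h2 => ?_, fun e s h1 h2 => ?_, fun e h1 h2 => ?_, Active S,
      fun e he => ⟨e, he, .start⟩, fun e he ⟨f, hf, h⟩ => ⟨f, hf, .step e (.inl he) h⟩,
      fun i hi ⟨f, hf, h⟩ => not_isFace_of_chain hf h hi hS⟩
    · refine not_isFace_of_quadratic h1 h2 (x' := .edge .line e) (y' := .edge .line e) ?_ ?_ ?_ hS
      · simp only [lt_iff_rank_lt, rank]; omega
      · simp only [lt_iff_rank_lt, rank]; omega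
      · simp only [point]; abel
    · by_contra hs
      cases s
      · refine not_isFace_of_quadratic h2 h1 (x' := .vert e.castSucc) (y' := .vert e.succ)
          ?_ ?_ ?_ hS
        · simp only [lt_iff_rank_lt, rank]; omega
        · simp only [lt_iff_rank_lt, rank]; omega
        · simp only [point]; abel
      · exact hs rfl
      · refine not_isFace_of_quadratic h2 h1 (x' := .vert e.castSucc) (y' := .vert e.castSucc)
          ?_ ?_ ?_ hS
        · simp only [lt_iff_rank_lt, rank]; omega
        · simp only [lt_iff_rank_lt, rank]; omega
        · simp only [point]; abel
      · refine not_isFace_of_quadratic h2 h1 (x' := .vert e.succ) (y' := .vert e.succ)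
          ?_ ?_ ?_ hS
        · simp only [lt_iff_rank_lt, rank]; omega
        · simp only [lt_iff_rank_lt, rank]; omega
        · simp only [point]; abel
    · refine not_isFace_of_quadratic h1 h2 (x' := .vert e.succ) (y' := .edge .line e) ?_ ?_ ?_ hS
      · simp only [lt_iff_rank_lt, rank]; omega
      · simp only [lt_iff_rank_lt, rank]; omega
      · simp only [point]; abel
  · intro hS
    refine isFace_lex_of_forall_exists K ?_
    rintro (i | ⟨_ | _ | _ | _, e⟩) hw
    · exact exists_functional_vert S i
    · exact hS.exists_functional_line hw
    · exact exists_functional_wave S e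
    · exact hS.exists_functional_right hw
    · exact hS.exists_functional_left hw

end CosmologicalPath

namespace CosmologicalPath

variable {n : ℕ}

open ToricTriangulation

/-! ### Local description of the facets -/

theorem doubleLeft_iff {S : Finset (PathVar n)} {e : Fin n} :
    DoubleLeft S e ↔ PathVar.edge .line e ∈ S ∧ PathVar.edge .left e ∈ S ∧
      PathVar.edge .wave e ∉ S ∧ PathVar.edge .right e ∉ S := by
  rw [DoubleLeft, Set.ext_iff]
  refine ⟨fun h => ?_, fun h s => ?_⟩
  · simpa [symbols] using And.intro (h .line) (And.intro (h .left) (And.intro (h .wave) (h .right)))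
  · cases s <;> simp [symbols, h]

theorem doubleRight_iff {S : Finset (PathVar n)} {e : Fin n} :
    DoubleRight S e ↔ PathVar.edge .line e ∈ S ∧ PathVar.edge .right e ∈ S ∧
      PathVar.edge .wave e ∉ S ∧ PathVar.edge .left e ∉ S := by
  rw [DoubleRight, Set.ext_iff]
  refine ⟨fun h => ?_, fun h s => ?_⟩
  · simpa [symbols] using And.intro (h .line) (And.intro (h .right) (And.intro (h .wave) (h .left)))
  · cases s <;> simp [symbols, h]

theorem single_iff {S : Finset (PathVar n)} {s : EdgeSymbol} {e : Fin n} :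
    Single S s e ↔ PathVar.edge s e ∈ S ∧ ∀ t, PathVar.edge t e ∈ S → t = s := by
  rw [Single, Set.eq_singleton_iff_unique_mem]
  rfl

theorem forall_edgeSymbol {p : EdgeSymbol → Prop} :
    (∀ s, p s) ↔ p .line ∧ p .wave ∧ p .right ∧ p .left :=
  ⟨fun h => ⟨h _, h _, h _, h _⟩, fun h s => by cases s <;> simp [h]⟩

/-- The local rules satisfied by the drawing of a facet whose active vertices are given by `A`. -/
structure LocalRules (S : Finset (PathVar n)) (A : Fin (n + 1) → Prop) : Prop where
  zero : ¬ A 0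
  last : PathVar.vert (Fin.last n) ∈ S ∨ A (Fin.last n)
  white : ∀ i, PathVar.vert i ∈ S → ¬ A i
  active_step : ∀ e : Fin n, A e.castSucc →
    (A e.succ ∧ (DoubleLeft S e ∨ DoubleRight S e)) ∨
      (¬ A e.succ ∧ (Single S .wave e ∨ Single S .left e))
  black_step : ∀ e : Fin n, ¬ A e.castSucc → PathVar.vert e.castSucc ∉ S →
    ¬ A e.succ ∧ DoubleLeft S e
  white_step : ∀ e : Fin n, PathVar.vert e.castSucc ∈ S →
    (A e.succ ∧ DoubleRight S e) ∨ (¬ A e.succ ∧ (Single S .wave e ∨ Single S .line e))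

theorem Avoids.isSeparating_active {S : Finset (PathVar n)} (hS : Avoids S) :
    IsSeparating S (Active S) := by
  obtain ⟨A, hA⟩ := hS.separating
  exact ⟨fun e he => ⟨e, he, .start⟩, fun e he ⟨f, hf, h⟩ => ⟨f, hf, .step e (.inl he) h⟩,
    fun i hi ⟨f, hf, h⟩ => hA.white i hi (hA.of_chain hf h)⟩

theorem active_succ {S : Finset (PathVar n)} {e : Fin n} (h : Active S e.succ) :
    PathVar.edge .right e ∈ S ∨ Active S e.castSucc ∧ PathVar.edge .line e ∈ S := by
  obtain ⟨f, hf, h⟩ := h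
  rcases chain_succ_iff.1 h with rfl | ⟨h, h1 | h1⟩
  exacts [.inl hf, .inr ⟨⟨f, hf, h⟩, h1⟩, .inl h1]

theorem not_active_zero {S : Finset (PathVar n)} : ¬ Active S 0 := fun ⟨_, _, h⟩ =>
  Fin.not_lt_zero _ h.lt

/-- A white vertex is reached from the vertex, rightwards along edges that carry a line. -/
inductive Reaches (S : Finset (PathVar n)) : Fin (n + 1) → Prop
  | white (i : Fin (n + 1)) (hi : PathVar.vert i ∈ S) : Reaches S i
  | step (e : Fin n) (he : PathVar.edge .line e ∈ S) (h : Reaches S e.succ) :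
      Reaches S e.castSucc

/-- This bounds every separating set from above, so the vertices that do not reach a white one form
the largest separating set. -/
theorem IsSeparating.not_of_reaches {S : Finset (PathVar n)} {A : Fin (n + 1) → Prop}
    (hA : IsSeparating S A) {i : Fin (n + 1)} (h : Reaches S i) : ¬ A i := by
  induction h with
  | white i hi => exact hA.white i hi
  | step e he _ ih => exact fun h => ih (hA.line e he h)

theorem IsSeparating.not_reaches {S : Finset (PathVar n)} {A : Fin (n + 1) → Prop}
    (hA : IsSeparating S A) : IsSeparating S fun i => ¬ Reaches S i :=
  ⟨fun e he h => hA.not_of_reaches h (hA.right e he), fun e he h h1 => h (.step e he h1),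
    fun i hi h => h (.white i hi)⟩

theorem Avoids.insert_vert {S : Finset (PathVar n)} (hS : Avoids S) {i : Fin (n + 1)}
    (h : ∀ e : Fin n, i = e.castSucc → PathVar.edge .left e ∉ S) (hi : ¬ Active S i) :
    Avoids (insert (.vert i) S) := by
  have hA := hS.isSeparating_active
  refine ⟨by simpa using hS.arrows, by simpa using hS.wave, fun e he => ?_, Active S,
    by simpa using hA.right, by simpa using hA.line, fun j hj => ?_⟩
  · have h1 := hS.left e
    have h2 := h e
    grind
  · have := hA.white j
    grind

/-- The set `A` is a free choice of separating set and has to remain separating after the insertion.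
A smaller `A` makes its hypothesis for a line easier at the left end, a larger one makes those for a
line or `→` easier at the right end. -/
theorem Avoids.insert_edge {S : Finset (PathVar n)} (hS : Avoids S) {s : EdgeSymbol} {e : Fin n}
    {A : Fin (n + 1) → Prop} (hA : IsSeparating S A)
    (hw : PathVar.edge .wave e ∈ S → s = .wave)
    (hs : s = .wave → ∀ t, PathVar.edge t e ∈ S → t = .wave)
    (hr : s = .right → PathVar.edge .left e ∉ S ∧ A e.succ)
    (hl : s = .left → PathVar.edge .right e ∉ S ∧ PathVar.vert e.castSucc ∉ S)
    (hz : s = .line → A e.castSucc → A e.succ) :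
    Avoids (insert (.edge s e) S) := by
  refine ⟨fun f => ?_, fun f t => ?_, fun f => ?_, A, fun f => ?_, fun f => ?_, fun i => ?_⟩
  · have := hS.arrows f
    grind
  · have := hS.wave f t
    have := hS.wave e t
    grind
  · have := hS.left f
    grind
  · have := hA.right f
    grind
  · have := hA.line f
    grind
  · have := hA.white i
    grind

/-- A variable missing from a maximal `S` must be blocked. Each kind of variable has a short list of
possible obstructions around its edge, and these lists together force the local rules. -/
theorem localRules_active_of_maximal {S : Finset (PathVar n)} (hS : Maximal Avoids S) :
    LocalRules S (Active S) := by
  have hA := hS.prop.isSeparating_active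
  have hR := hA.not_reaches
  have hmem : ∀ x, Avoids (insert x S) → x ∈ S := fun x hx =>
    hS.le_of_ge hx (Finset.subset_insert x S) (Finset.mem_insert_self x S)
  have hlast : PathVar.vert (Fin.last n) ∈ S ∨ Active S (Fin.last n) := by
    by_contra! h
    exact h.1 (hmem _ (hS.prop.insert_vert (fun e he => absurd he.symm e.castSucc_ne_last) h.2))
  have hvert : ∀ e : Fin n, PathVar.vert e.castSucc ∈ S ∨ PathVar.edge .left e ∈ S ∨
      Active S e.castSucc := by
    intro e
    by_contra! h
    refine h.1 (hmem _ (hS.prop.insert_vert (fun f hf => ?_) h.2.2))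
    rw [← Fin.castSucc_inj.1 hf]
    exact h.2.1
  have hline : ∀ e, PathVar.edge .line e ∈ S ∨ PathVar.edge .wave e ∈ S ∨
      Active S e.castSucc ∧ Reaches S e.succ := by
    intro e
    by_contra! h
    -- If the left end is active, every separating set contains it, and only the largest one is sure
    -- to contain the right end. Otherwise the smallest one satisfies the condition vacuously.
    by_cases h1 : Active S e.castSucc
    · exact h.1 (hmem _ (hS.prop.insert_edge hR (by simp [h]) (by simp) (by simp) (by simp)
        fun _ _ => h.2.2 h1))
    · exact h.1 (hmem _ (hS.prop.insert_edge hA (by simp [h]) (by simp) (by simp) (by simp)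
        fun _ h2 => absurd h2 h1))
  have hleft : ∀ e, PathVar.edge .left e ∈ S ∨ PathVar.edge .right e ∈ S ∨
      PathVar.edge .wave e ∈ S ∨ PathVar.vert e.castSucc ∈ S := by
    intro e
    by_contra! h
    exact h.1 (hmem _ (hS.prop.insert_edge hA (by simp [h]) (by simp) (by simp) (by simp [h])
      (by simp)))
  have hright : ∀ e, PathVar.edge .right e ∈ S ∨ PathVar.edge .left e ∈ S ∨
      PathVar.edge .wave e ∈ S ∨ Reaches S e.succ := by
    intro e
    by_contra! h
    exact h.1 (hmem _ (hS.prop.insert_edge hR (by simp [h]) (by simp) (by simp [h]) (by simp)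
      (by simp)))
  -- All that is known about the symbols and the two ends of one edge; from here the rules are a
  -- propositional case check.
  have key : ∀ e : Fin n, _ := fun e => And.intro (hvert e) <| And.intro (hline e) <|
    And.intro (hleft e) <| And.intro (hright e) <| And.intro (hS.prop.arrows e) <|
    And.intro (forall_edgeSymbol.1 (hS.prop.wave e)) <| And.intro (hS.prop.left e) <|
    And.intro (hA.right e) <| And.intro (hA.line e) <|
    And.intro (hA.white e.castSucc) <| And.intro (hA.not_of_reaches (i := e.succ)) <|
    active_succ (S := S) (e := e)
  refine ⟨not_active_zero, hlast, hA.white, fun e => ?_, fun e => ?_, fun e => ?_⟩ <;>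
  · have := key e
    simp only [doubleLeft_iff, doubleRight_iff, single_iff, forall_edgeSymbol, reduceCtorEq,
      implies_true, imp_false, true_and, and_true] at this ⊢
    grind

theorem LocalRules.avoids {S : Finset (PathVar n)} {A : Fin (n + 1) → Prop}
    (h : LocalRules S A) : Avoids S := by
  have key : ∀ e : Fin n, _ := fun e => And.intro (h.active_step e) <|
    And.intro (h.black_step e) <| And.intro (h.white_step e) (h.white e.castSucc)
  simp only [doubleLeft_iff, doubleRight_iff, single_iff, forall_edgeSymbol, reduceCtorEq,
      implies_true, imp_false, true_and, and_true] at key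
  refine ⟨fun e => ?_, fun e => forall_edgeSymbol.2 ?_, fun e => ?_, A, fun e => ?_, fun e => ?_,
    h.white⟩
  · have := key e
    grind
  · have := key e
    simp only [reduceCtorEq, implies_true, imp_false, true_and]
    grind
  · have := key e
    grind
  · have := key e
    grind
  · have := key e
    grind

/-- From the left, every active vertex is forced into `B` by a `→`, or by a line leaving an active
vertex. From the right, an inactive vertex is white or has a line to an inactive vertex, so it is
kept out of `B`. -/
theorem LocalRules.eq_of_isSeparating {S : Finset (PathVar n)} {A B : Fin (n + 1) → Prop}
    (h : LocalRules S A) (hB : IsSeparating S B) : B = A := by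
  have h1 : ∀ i, A i → B i := by
    intro i
    induction i using Fin.induction with
    | zero => exact fun h0 => absurd h0 h.zero
    | succ e ih =>
      intro he
      by_cases hA : A e.castSucc
      · rcases h.active_step e hA with ⟨_, h1 | h1⟩ | ⟨h1, _⟩
        · exact hB.line e (doubleLeft_iff.1 h1).1 (ih hA)
        · exact hB.right e (doubleRight_iff.1 h1).2.1
        · exact absurd he h1
      · by_cases hw : PathVar.vert e.castSucc ∈ S
        · rcases h.white_step e hw with ⟨_, h1⟩ | ⟨h1, _⟩
          · exact hB.right e (doubleRight_iff.1 h1).2.1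
          · exact absurd he h1
        · exact absurd he (h.black_step e hA hw).1
  have h2 : ∀ i, ¬ A i → ¬ B i := by
    intro i
    induction i using Fin.reverseInduction with
    | last => exact fun h0 => hB.white _ (h.last.resolve_right h0)
    | cast e ih =>
      intro hA
      by_cases hw : PathVar.vert e.castSucc ∈ S
      · exact hB.white _ hw
      · obtain ⟨h1, h2⟩ := h.black_step e hA hw
        exact fun h3 => ih h1 (hB.line e (doubleLeft_iff.1 h2).1 h3)
  exact funext fun i => propext ⟨fun hi => by_contra fun h0 => h2 i h0 hi, h1 i⟩

/-- A separating set of the larger `T` also separates `S`, so by uniqueness it is `A`. With `A`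
fixed, the rules at a single edge or vertex already exclude each missing variable. -/
theorem LocalRules.maximal {S : Finset (PathVar n)} {A : Fin (n + 1) → Prop}
    (h : LocalRules S A) : Maximal Avoids S := by
  refine ⟨h.avoids, fun T hT hST x hx => ?_⟩
  by_contra hxS
  obtain ⟨B, hB⟩ := hT.separating
  obtain rfl : B = A := h.eq_of_isSeparating
    ⟨fun e he => hB.right e (hST he), fun e he => hB.line e (hST he),
      fun i hi => hB.white i (hST hi)⟩
  rcases x with i | ⟨s, e⟩
  · rcases Fin.eq_castSucc_or_eq_last i with ⟨e, rfl⟩ | rfl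
    · exact hT.left e (hST (doubleLeft_iff.1 (h.black_step e (hB.white _ hx) hxS).2).2.1) hx
    · exact hB.white _ hx (h.last.resolve_left hxS)
  · have key := And.intro (h.active_step e) <|
      And.intro (h.black_step e) <| And.intro (h.white_step e) <|
      And.intro (hT.arrows e) <| And.intro (forall_edgeSymbol.1 (hT.wave e)) <|
      And.intro (hT.left e) <| And.intro (hB.right e) <| And.intro (hB.line e)
        (hB.white e.castSucc)
    have hs : ∀ t, PathVar.edge t e ∈ S → PathVar.edge t e ∈ T := fun t ht => hST ht
    have hv : PathVar.vert e.castSucc ∈ S → PathVar.vert e.castSucc ∈ T := fun ht => hST ht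
    rw [forall_edgeSymbol] at hs
    simp only [doubleLeft_iff, doubleRight_iff, single_iff, forall_edgeSymbol, reduceCtorEq,
      implies_true, imp_false, true_and, and_true] at key
    cases s <;> grind

theorem isPathFacet_iff_localRules (K : Type*) [Field K] (S : Finset (PathVar n)) :
    IsPathFacet K S ↔ ∃ A, LocalRules S A := by
  have : IsFace K MonomialOrder.lex (point (n := n)) = Avoids :=
    funext fun S => propext (isFace_iff_avoids K S)
  rw [IsPathFacet, IsFacet, this]
  exact ⟨fun h => ⟨_, localRules_active_of_maximal h⟩, fun ⟨_, h⟩ => h.maximal⟩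

end CosmologicalPath

namespace CosmologicalPath

variable {n : ℕ}

/-! ### The shape of a drawing with local rules -/

theorem castSucc_lt_iff_succ_le {e : Fin n} {i : Fin (n + 1)} : e.castSucc < i ↔ e.succ ≤ i := by
  simp [Fin.lt_def, Fin.le_def]

theorem lt_succ_iff_le_castSucc {e : Fin n} {i : Fin (n + 1)} : i < e.succ ↔ i ≤ e.castSucc := by
  simp [Fin.lt_def, Fin.le_def]

theorem exists_castSucc_eq_of_lt {a b : Fin (n + 1)} (h : a < b) : ∃ e : Fin n, a = e.castSucc :=
  (Fin.eq_castSucc_or_eq_last a).resolve_right (h.trans_le (Fin.le_last b)).ne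

/-- Activity is created only at the edge after a white vertex. The range of `c` excludes `k`, so the
next white vertex itself may serve as `k`. -/
theorem LocalRules.inactive {S : Finset (PathVar n)} {A : Fin (n + 1) → Prop}
    (h : LocalRules S A) {m : Fin (n + 1)} (hm : ¬ A m) (k : Fin (n + 1)) (hmk : m ≤ k)
    (hw : ∀ c, m ≤ c → c < k → ¬ IsWhite S c) : ¬ A k := by
  induction k using Fin.induction with
  | zero => rwa [← Fin.le_zero_iff.1 hmk]
  | succ e ih =>
    rcases hmk.eq_or_lt with rfl | hmk
    · exact hm
    · rw [lt_succ_iff_le_castSucc] at hmk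
      refine (h.black_step e (ih hmk fun c h1 h2 => hw c h1 (h2.trans Fin.castSucc_lt_succ)) ?_).1
      exact hw _ hmk Fin.castSucc_lt_succ

theorem LocalRules.exists_isWhite {S : Finset (PathVar n)} {A : Fin (n + 1) → Prop}
    (h : LocalRules S A) : ∃ i, IsWhite S i := by
  by_contra! hw
  exact h.inactive h.zero (Fin.last n) (Fin.zero_le _) (fun c _ _ => hw c)
    (h.last.resolve_left (hw _))

theorem LocalRules.leftPart {S : Finset (PathVar n)} {A : Fin (n + 1) → Prop}
    (h : LocalRules S A) {a : Fin (n + 1)} (ha : IsLeast {i | IsWhite S i} a) :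
    LeftPart S a := by
  intro e he
  rw [← castSucc_lt_iff_succ_le] at he
  have hw : ∀ c, c < a → ¬ IsWhite S c := fun c hc h => (ha.2 h).not_gt hc
  exact (h.black_step e (h.inactive h.zero _ (Fin.zero_le _) fun c _ hc => hw c (hc.trans he))
    (hw _ he)).2

theorem LocalRules.rightPart {S : Finset (PathVar n)} {A : Fin (n + 1) → Prop}
    (h : LocalRules S A) {b : Fin (n + 1)} (hb : IsGreatest {i | IsWhite S i} b) :
    RightPart S b := by
  have hw : ∀ c, b < c → ¬ IsWhite S c := fun c hc h => (hb.2 h).not_gt hc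
  have hA : ∀ k, b < k → A k := by
    intro k hk
    by_contra hAk
    refine h.inactive hAk (Fin.last n) (Fin.le_last k) (fun c hc _ => hw c (hk.trans_le hc)) ?_
    exact h.last.resolve_left (hw _ (hk.trans_le (Fin.le_last k)))
  refine fun e => ⟨?_, fun he => ?_⟩
  · rintro rfl
    exact ((h.white_step e hb.1).resolve_right fun h1 => h1.1 (hA _ Fin.castSucc_lt_succ)).2
  · exact ((h.active_step e (hA _ he)).resolve_right fun h1 =>
      h1.1 (hA _ (he.trans Fin.castSucc_lt_succ))).2

/-- The active vertices between `a` and `b` form a possibly empty run that starts right after `a`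
and ends before `b`, since `b` is white. The single edge is where the run ends, or the first edge if
the run is empty. -/
theorem LocalRules.consecutiveWhite {S : Finset (PathVar n)} {A : Fin (n + 1) → Prop}
    (h : LocalRules S A) {a b : Fin (n + 1)} (hab : ConsecutiveWhite S a b) :
    InnerForm S .wave a b ∨ InnerForm S .left a b ∨ FirstForm S .wave a b ∨
      FirstForm S .line a b := by
  obtain ⟨hlt, ha, hb, hw⟩ := hab
  obtain ⟨e₀, rfl⟩ := exists_castSucc_eq_of_lt hlt
  have hdl : ∀ m, e₀.castSucc < m → ¬ A m → ∀ f : Fin n, m ≤ f.castSucc → f.succ ≤ b →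
      DoubleLeft S f := by
    intro m hm hAm f hf hfb
    rw [← castSucc_lt_iff_succ_le] at hfb
    exact (h.black_step f (h.inactive hAm _ hf fun c h1 h2 =>
      hw c (hm.trans_le h1) (h2.trans hfb)) (hw _ (hm.trans_le hf) hfb)).2
  have hfirst : ∀ s, Single S s e₀ → ¬ A e₀.succ → FirstForm S s e₀.castSucc b := by
    intro s hs hA f hf
    refine ⟨fun he => ?_, fun he => hdl _ Fin.castSucc_lt_succ hA f ?_ hf.2⟩
    · rwa [← Fin.castSucc_inj.1 he]
    · rwa [← castSucc_lt_iff_succ_le]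
  rcases h.white_step e₀ ha with ⟨hA, hdr⟩ | ⟨hA, h1 | h1⟩
  · obtain ⟨e, he, hAe, hAe', heb⟩ : ∃ e : Fin n, e₀.castSucc < e.castSucc ∧ A e.castSucc ∧
        ¬ A e.succ ∧ e.succ ≤ b := by
      by_contra! hcon
      have hall : ∀ k, e₀.castSucc < k → k ≤ b → A k := by
        intro k
        induction k using Fin.induction with
        | zero => exact fun h0 => absurd h0 (Fin.not_lt_zero _)
        | succ e ih =>
          intro h1 h2
          by_contra h3
          rcases (lt_succ_iff_le_castSucc.1 h1).eq_or_lt with h4 | h4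
          · exact h3 (Fin.castSucc_inj.1 h4 ▸ hA)
          · exact (hcon e h4 (ih h4 (Fin.castSucc_lt_succ.le.trans h2)) h3).not_ge h2
      exact h.white b hb (hall b hlt le_rfl)
    have hbefore : ∀ k, e₀.castSucc < k → k ≤ e.castSucc → A k := by
      intro k h1 h2
      by_contra h3
      exact h.inactive h3 _ h2 (fun c h4 h5 => hw c (h1.trans_le h4)
        (h5.trans (castSucc_lt_iff_succ_le.2 heb))) hAe
    have hsingle := ((h.active_step e hAe).resolve_left fun h1 => hAe' h1.1).2
    have hform : ∀ s, Single S s e → InnerForm S s e₀.castSucc b := by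
      refine fun s hs => ⟨e, ⟨he.le, heb⟩, he, hs, fun f hf => ⟨fun hef => ?_, fun _ h1 => ?_,
        fun hfe h1 => ?_⟩⟩
      · refine hdl e.succ (he.trans Fin.castSucc_lt_succ) hAe' f ?_ hf.2
        rw [← castSucc_lt_iff_succ_le]
        exact hef
      · rwa [← Fin.castSucc_inj.1 h1]
      · refine ((h.active_step f (hbefore _ h1 (le_of_lt hfe))).resolve_right fun h2 => h2.1 ?_).2
        refine hbefore _ (h1.trans Fin.castSucc_lt_succ) ?_
        rw [← castSucc_lt_iff_succ_le]
        exact hfe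
    exact hsingle.elim (fun hs => .inl (hform _ hs)) fun hs => .inr (.inl (hform _ hs))
  · exact .inr (.inr (.inl (hfirst _ h1 hA)))
  · exact .inr (.inr (.inr (hfirst _ h1 hA)))

/-- There is a white vertex strictly to the left of `i` such that all vertices after it, up to `i`,
are black, and all edges between it and `i` are double. -/
def AfterDoubles (S : Finset (PathVar n)) (i : Fin (n + 1)) : Prop :=
  ∃ a < i, IsWhite S a ∧ (∀ c, a < c → c ≤ i → ¬ IsWhite S c) ∧
    ∀ f : Fin n, a ≤ f.castSucc → f.succ ≤ i → DoubleLeft S f ∨ DoubleRight S f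

theorem Single.not_double {S : Finset (PathVar n)} {s : EdgeSymbol} {e : Fin n}
    (h : Single S s e) : ¬ (DoubleLeft S e ∨ DoubleRight S e) := by
  rw [single_iff] at h
  rw [doubleLeft_iff, doubleRight_iff]
  rintro (h1 | h1)
  · exact nomatch (h.2 _ h1.1).trans (h.2 _ h1.2.1).symm
  · exact nomatch (h.2 _ h1.1).trans (h.2 _ h1.2.1).symm

/-- The white vertex witnessing `AfterDoubles` is the last one before `i`, so it coincides with `a`.
-/
theorem AfterDoubles.double {S : Finset (PathVar n)} {a i : Fin (n + 1)} (h : AfterDoubles S i)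
    (ha : IsWhite S a) (hi : a < i) {f : Fin n}
    (hf : a ≤ f.castSucc) (hfi : f.succ ≤ i) (hw : ∀ c, a < c → c < i → ¬ IsWhite S c) :
    DoubleLeft S f ∨ DoubleRight S f := by
  obtain ⟨a', hi', ha', hw', hd⟩ := h
  rcases lt_trichotomy a a' with h1 | rfl | h1
  · exact absurd ha' (hw a' h1 hi')
  · exact hd f hf hfi
  · exact absurd ha (hw' a h1 hi.le)

theorem exists_last_white {S : Finset (PathVar n)} {i c : Fin (n + 1)} (hc : c ≤ i)
    (h : IsWhite S c) : ∃ a ≤ i, IsWhite S a ∧ ∀ c, a < c → c ≤ i → ¬ IsWhite S c := by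
  obtain ⟨a, ha, hmax⟩ := Set.exists_max_image {c | c ≤ i ∧ IsWhite S c} id (Set.toFinite _)
    ⟨c, hc, h⟩
  exact ⟨a, ha.1, ha.2, fun c h1 h2 h3 => (hmax c ⟨h2, h3⟩).not_gt h1⟩

theorem exists_next_white {S : Finset (PathVar n)} {i c : Fin (n + 1)} (hc : i < c)
    (h : IsWhite S c) : ∃ b, i < b ∧ IsWhite S b ∧ ∀ c, i < c → c < b → ¬ IsWhite S c := by
  obtain ⟨b, hb, hmin⟩ := Set.exists_min_image {c | i < c ∧ IsWhite S c} id (Set.toFinite _)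
    ⟨c, hc, h⟩
  exact ⟨b, hb.1, hb.2, fun c h1 h2 h3 => (hmin c ⟨h1, h3⟩).not_gt h2⟩

/-- Around a vertex `i` with a last white vertex `a ≤ i`, either there is a next white vertex or `a`
is the last white vertex of the path. -/
theorem exists_consecutiveWhite_or_isGreatest {S : Finset (PathVar n)} {a i : Fin (n + 1)}
    (hai : a ≤ i) (ha : IsWhite S a) (hw : ∀ c, a < c → c ≤ i → ¬ IsWhite S c) :
    (∃ b, i < b ∧ ConsecutiveWhite S a b) ∨ IsGreatest {i | IsWhite S i} a := by
  by_cases h : ∃ c, i < c ∧ IsWhite S c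
  · obtain ⟨c, hc, hcw⟩ := h
    obtain ⟨b, hb, hbw, hmin⟩ := exists_next_white hc hcw
    refine .inl ⟨b, hb, hai.trans_lt hb, ha, hbw, fun c h1 h2 => ?_⟩
    rcases le_or_gt c i with h3 | h3
    exacts [hw c h1 h3, hmin c h3 h2]
  · push Not at h
    refine .inr ⟨ha, fun c hc => ?_⟩
    by_contra! h1
    rcases le_or_gt c i with h3 | h3
    exacts [hw c h1 h3 hc, h c h3 hc]

theorem RightPart.double {S : Finset (PathVar n)} {b : Fin (n + 1)} (h : RightPart S b)
    {e : Fin n} (he : b ≤ e.castSucc) : DoubleLeft S e ∨ DoubleRight S e :=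
  he.eq_or_lt.elim (fun h1 => .inr ((h e).1 h1)) (h e).2

/-- In a drawing of the given shapes, the active vertices must be those separated from the preceding
white vertex by double edges only, because the unique single edge of a segment ends the active run.
Each rule is then checked according to the position of the edge relative to that single edge. -/
theorem localRules_afterDoubles {S : Finset (PathVar n)} (hne : ∃ i, IsWhite S i)
    (hleft : ∀ a, IsLeast {i | IsWhite S i} a → LeftPart S a)
    (hmid : ∀ a b, ConsecutiveWhite S a b →
      ((∃ s, (s = .wave ∨ s = .left) ∧ InnerForm S s a b) ∨
        ∃ s, (s = .wave ∨ s = .line) ∧ FirstForm S s a b))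
    (hright : ∀ b, IsGreatest {i | IsWhite S i} b → RightPart S b) :
    LocalRules S (AfterDoubles S) := by
  have hwhite : ∀ i, PathVar.vert i ∈ S → ¬ AfterDoubles S i :=
    fun i hi ⟨a, ha, _, hw, _⟩ => hw i ha le_rfl hi
  have hsingle : ∀ s (e : Fin n), Single S s e → ¬ AfterDoubles S e.succ := by
    rintro s e hs ⟨a, ha, -, -, hd⟩
    exact hs.not_double (hd e (lt_succ_iff_le_castSucc.1 ha) le_rfl)
  refine ⟨fun ⟨a, ha, _⟩ => Fin.not_lt_zero _ ha, ?_, hwhite, fun e he => ?_, fun e he hb => ?_,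
    fun e he => ?_⟩
  · by_contra! hl
    obtain ⟨i, hi⟩ := hne
    obtain ⟨a, hal, ha, hw⟩ := exists_last_white (Fin.le_last i) hi
    have hlt : a < Fin.last n := hal.lt_of_ne (by rintro rfl; exact hl.1 ha)
    refine hl.2 ⟨a, hlt, ha, hw, fun f hf _ => (hright a ⟨ha, fun c hc => ?_⟩).double hf⟩
    by_contra! h1
    exact hw c h1 (Fin.le_last c) hc
  · obtain ⟨a, hlt, ha, hw, hd⟩ := he
    have hstep : (DoubleLeft S e ∨ DoubleRight S e) → ¬ IsWhite S e.succ →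
        AfterDoubles S e.succ := by
      refine fun h1 h2 => ⟨a, hlt.trans Fin.castSucc_lt_succ, ha, fun c h3 h4 => ?_,
        fun f h3 h4 => ?_⟩
      · rcases h4.eq_or_lt with rfl | h4
        exacts [h2, hw c h3 (lt_succ_iff_le_castSucc.1 h4)]
      · rcases h4.eq_or_lt with h4 | h4
        · rwa [Fin.succ_inj.1 h4]
        · exact hd f h3 (lt_succ_iff_le_castSucc.1 h4)
    rcases exists_consecutiveWhite_or_isGreatest hlt.le ha hw with ⟨b, hb, hab⟩ | hg
    · rcases hmid a b hab with ⟨s, hs, e', he', hae', hs', hf⟩ | ⟨s, hs, hf⟩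
      · rcases lt_trichotomy e e' with h1 | rfl | h1
        · have hdbl := (hf e ⟨hlt.le, castSucc_lt_iff_succ_le.1 hb⟩).2.2 h1 hlt
          refine .inl ⟨hstep hdbl (hab.2.2.2 _ (hlt.trans Fin.castSucc_lt_succ) ?_), hdbl⟩
          refine (Fin.succ_lt_succ_iff.2 h1).trans_le he'.2
        · refine .inr ⟨hsingle _ _ hs', ?_⟩
          rcases hs with rfl | rfl
          exacts [.inl hs', .inr hs']
        · exact absurd (hd e' hae'.le (castSucc_lt_iff_succ_le.1 (show e'.castSucc < e.castSucc
            from h1))) hs'.not_double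
      · obtain ⟨f, rfl⟩ := exists_castSucc_eq_of_lt hlt
        have h1 := (hf f ⟨le_rfl, castSucc_lt_iff_succ_le.1 hab.1⟩).1 rfl
        exact absurd (hd f le_rfl (castSucc_lt_iff_succ_le.1 hlt)) h1.not_double
    · have hdbl := (hright a hg).double hlt.le
      exact .inl ⟨hstep hdbl fun h => (hg.2 h).not_gt (hlt.trans Fin.castSucc_lt_succ), hdbl⟩
  · by_cases hc : ∃ c ≤ e.castSucc, IsWhite S c
    · obtain ⟨c, hc, hcw⟩ := hc
      obtain ⟨a, hle, ha, hw⟩ := exists_last_white hc hcw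
      have hlt : a < e.castSucc := hle.lt_of_ne (by rintro rfl; exact hb ha)
      have hnot : ∀ s f, Single S s f → a ≤ f.castSucc → f.succ ≤ e.succ →
          ¬ AfterDoubles S e.succ := fun s f hs h1 h2 h3 =>
        hs.not_double (h3.double ha (hlt.trans Fin.castSucc_lt_succ) h1 h2 fun c h4 h5 =>
          hw c h4 (lt_succ_iff_le_castSucc.1 h5))
      rcases exists_consecutiveWhite_or_isGreatest hlt.le ha hw with ⟨b, hb, hab⟩ | hg
      · rcases hmid a b hab with ⟨s, hs, e', he', hae', hs', hf⟩ | ⟨s, hs, hf⟩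
        · rcases lt_or_ge e' e with h1 | h1
          · exact ⟨hnot s e' hs' hae'.le (Fin.succ_le_succ_iff.2 h1.le),
              (hf e ⟨hlt.le, castSucc_lt_iff_succ_le.1 hb⟩).1 h1⟩
          · refine absurd ⟨a, hlt, ha, hw, fun f h2 h3 => ?_⟩ he
            have h4 : f < e := castSucc_lt_iff_succ_le.2 h3
            have h5 := hf f ⟨h2, h3.trans hb.le⟩
            rcases h2.eq_or_lt with h6 | h6
            exacts [.inr (h5.2.1 (h4.trans_le h1) h6), h5.2.2 (h4.trans_le h1) h6]
        · obtain ⟨f, rfl⟩ := exists_castSucc_eq_of_lt hlt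
          have h1 := (hf f ⟨le_rfl, castSucc_lt_iff_succ_le.1 hab.1⟩).1 rfl
          exact ⟨hnot s f h1 le_rfl (Fin.succ_le_succ_iff.2 (le_of_lt hlt)),
            (hf e ⟨hlt.le, castSucc_lt_iff_succ_le.1 hb⟩).2 hlt⟩
      · exact absurd ⟨a, hlt, ha, hw, fun f h2 _ => (hright a hg).double h2⟩ he
    · push Not at hc
      refine ⟨fun ⟨a, hlt, ha, _⟩ => hc a (lt_succ_iff_le_castSucc.1 hlt) ha, ?_⟩
      obtain ⟨i, hi⟩ := hne
      obtain ⟨a, hlt, ha, hw⟩ := exists_next_white (i := e.castSucc)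
        (lt_of_not_ge fun h => hc i h hi) hi
      refine hleft a ⟨ha, fun c hcw => ?_⟩ e (castSucc_lt_iff_succ_le.1 hlt)
      by_contra! h
      exact hw c (lt_of_not_ge fun h => hc c h hcw) h hcw
  · have hstep : DoubleRight S e → ¬ IsWhite S e.succ → AfterDoubles S e.succ := by
      refine fun h1 h2 => ⟨e.castSucc, Fin.castSucc_lt_succ, he, fun c h3 h4 => ?_,
        fun f h3 h4 => ?_⟩
      · rwa [h4.antisymm (castSucc_lt_iff_succ_le.1 h3)]
      · rw [show f = e from le_antisymm (Fin.succ_le_succ_iff.1 h4) h3]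
        exact .inr h1
    rcases exists_consecutiveWhite_or_isGreatest le_rfl he
      (fun c h1 h2 => absurd h2 h1.not_ge) with ⟨b, hb, hab⟩ | hg
    · have hbt : Between e.castSucc b e := ⟨le_rfl, castSucc_lt_iff_succ_le.1 hb⟩
      rcases hmid _ b hab with ⟨s, hs, e', he', hae', hs', hf⟩ | ⟨s, hs, hf⟩
      · have h1 := (hf e hbt).2.1 hae' rfl
        refine .inl ⟨hstep h1 (hab.2.2.2 _ Fin.castSucc_lt_succ ?_), h1⟩
        exact (Fin.succ_lt_succ_iff.2 (show e < e' from hae')).trans_le he'.2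
      · have h1 := (hf e hbt).1 rfl
        refine .inr ⟨hsingle s e h1, ?_⟩
        rcases hs with rfl | rfl
        exacts [.inl h1, .inr h1]
    · have h1 := (hright _ hg e).1 rfl
      exact .inl ⟨hstep h1 fun h => (hg.2 h).not_gt Fin.castSucc_lt_succ, h1⟩

end CosmologicalPath

theorem mainTheorem6 (K : Type*) [Field K] (n : ℕ)
    (S : Finset (CosmologicalPath.PathVar n)) :
    CosmologicalPath.IsPathFacet K S ↔
      (∃ i, CosmologicalPath.IsWhite S i) ∧
      (∀ a, IsLeast {i | CosmologicalPath.IsWhite S i} a → CosmologicalPath.LeftPart S a) ∧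
      (∀ a b, CosmologicalPath.ConsecutiveWhite S a b →
        CosmologicalPath.InnerForm S .wave a b ∨
        CosmologicalPath.InnerForm S .left a b ∨
        CosmologicalPath.FirstForm S .wave a b ∨
        CosmologicalPath.FirstForm S .line a b) ∧
      (∀ b, IsGreatest {i | CosmologicalPath.IsWhite S i} b →
        CosmologicalPath.RightPart S b) := by
  rw [CosmologicalPath.isPathFacet_iff_localRules]
  constructor
  · rintro ⟨A, h⟩
    exact ⟨h.exists_isWhite, fun _ ha => h.leftPart ha, fun _ _ hab => h.consecutiveWhite hab,
      fun _ hb => h.rightPart hb⟩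
  · rintro ⟨hne, hleft, hmid, hright⟩
    refine ⟨_, CosmologicalPath.localRules_afterDoubles hne hleft (fun a b hab => ?_) hright⟩
    rcases hmid a b hab with h | h | h | h
    · exact .inl ⟨_, .inl rfl, h⟩
    · exact .inl ⟨_, .inr rfl, h⟩
    · exact .inr ⟨_, .inl rfl, h⟩
    · exact .inr ⟨_, .inr rfl, h⟩
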